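/- Let $\mathcal{X}$ and $\mathcal{Y}$ be finite sets with $\mathcal X\neq\emptyset$, and let $W$ be a discrete memoryless channel with input alphabet $\mathcal{X}$, output alphabet $\mathcal{Y}$ and transition probabilities $W(y|x)$. For $n\ge 1$ and $M\ge 1$ let $P_{\mathrm e}(n,M,W)$ be the minimum, over all block codes of length $n$ with $M$ codewords and all decoders, of the error probability averaged over $M$ equiprobable messages. The reliability function of $W$ is $$E(R,W)=\limsup_{n\to\infty}-\frac1n\log_2 P_{\mathrm e}\big(n,\lceil 2^{nR}\rceil,W\big),$$ where $-\log_2 0=+\infty$. Let $$E_{\mathrm{sp}}(R,W)=\sup_{\rho\ge 0}\Big[\max_q\Big(-\log_2\sum_{y\in\mathcal Y}\Big(\sum_{x\in\mathcal X}q(x)W(y|x)^{1/(1+\rho)}\Big)^{1+\rho}\Big)-\rho R\Big]$$ be the sphere-packing exponent, where $q$ ranges over the probability distributions on $\mathcal X$, and let $R_\infty$ be the smallest $R\ge 0$ for which $E_{\mathrm{sp}}(R,W)$ is finite (such a smallest $R$ exists). Then $E(R,W)$ is finite and continuous in $R$ at every $R>R_\infty$. In particular, for the binary symmetric channel with crossover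 probability $p$, $0<p<1/2$, the reliability function is finite and continuous at every $R>0$. -/

import Mathlib

open scoped BigOperators

noncomputable section

/-- A discrete memoryless channel with input alphabet `X` and output alphabet `Y`
(both finite): a stochastic matrix, `prob x y` being the probability that the output letter is
`y` when the input letter is `x`. -/
structure DMC (X Y : Type*) [Fintype Y] where
  prob : X → Y → ℝ
  prob_nonneg : ∀ x y, 0 ≤ prob x y
  prob_sum : ∀ x, ∑ y, prob x y = 1

namespace DMC

variable {X Y : Type*} [Fintype X] [Fintype Y]

/-- Probability that `n` uses of the memoryless channel turn the input word `x` into the output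
word `y`. -/
def wordProb (W : DMC X Y) {n : ℕ} (x : Fin n → X) (y : Fin n → Y) : ℝ :=
  ∏ i, W.prob (x i) (y i)

open Classical in
/-- Average error probability, over `M` equiprobable messages, of the block code of length `n`
with encoder (codebook) `f` and decoder `g`. -/
def avgError (W : DMC X Y) {n M : ℕ} (f : Fin M → Fin n → X) (g : (Fin n → Y) → Fin M) : ℝ :=
  (∑ m : Fin M, ∑ y : Fin n → Y, if g y = m then 0 else W.wordProb (f m) y) / M

/-- `P_e(n, M, W)`: the minimum average error probability over all block codes of length `n` with
`M` codewords and all decoders. For `M ≥ 1` this is an infimum over a finite nonempty family, hence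
a minimum. -/
def minError (W : DMC X Y) (n M : ℕ) : ℝ :=
  ⨅ c : (Fin M → Fin n → X) × ((Fin n → Y) → Fin M), W.avgError c.1 c.2

/-- `-log₂ t` for `t ≥ 0`, with value `+∞` at `t = 0`. -/
def negLogTwo (t : ℝ) : EReal :=
  if t ≤ 0 then ⊤ else ((-Real.logb 2 t : ℝ) : EReal)

/-- The reliability function
`E(R, W) = limsup_{n → ∞} -(1/n) log₂ P_e(n, ⌈2^{nR}⌉, W)`, with values in `[-∞, ∞]`. -/
def reliability (W : DMC X Y) (R : ℝ) : EReal :=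
  Filter.limsup
    (fun n : ℕ => negLogTwo (W.minError n ⌈(2 : ℝ) ^ ((n : ℝ) * R)⌉₊) / (n : EReal))
    Filter.atTop

/-- `E_0(ρ, q) = -log₂ ∑_y (∑_x q(x) W(y|x)^{1/(1+ρ)})^{1+ρ}`. -/
def gallagerFun (W : DMC X Y) (ρ : ℝ) (q : X → ℝ) : ℝ :=
  -Real.logb 2 (∑ y, (∑ x, q x * W.prob x y ^ (1 / (1 + ρ))) ^ (1 + ρ))

/-- `E_0(ρ) = max_q E_0(ρ, q)`, over all probability vectors `q` on `X`. -/
def gallagerMax (W : DMC X Y) (ρ : ℝ) : EReal :=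
  ⨆ q ∈ stdSimplex ℝ X, (W.gallagerFun ρ q : EReal)

/-- The sphere-packing exponent `E_sp(R, W) = sup_{ρ ≥ 0} (E_0(ρ) - ρ R)`, possibly `+∞`. -/
def spherePacking (W : DMC X Y) (R : ℝ) : EReal :=
  ⨆ ρ ∈ Set.Ici (0 : ℝ), (W.gallagerMax ρ - ((ρ * R : ℝ) : EReal))

/-- The nonnegative rates at which the sphere-packing exponent is finite. -/
def finiteRates (W : DMC X Y) : Set ℝ :=
  {R : ℝ | 0 ≤ R ∧ W.spherePacking R < ⊤}

/-- `R_∞`: the smallest `R ≥ 0` for which the sphere-packing exponent is finite. -/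
def rInfty (W : DMC X Y) : ℝ := sInf W.finiteRates

end DMC

/-- The binary symmetric channel with crossover probability `p`. -/
def bsc (p : ℝ) (h0 : 0 ≤ p) (h1 : p ≤ 1) : DMC Bool Bool where
  prob x y := if x = y then 1 - p else p
  prob_nonneg x y := by split_ifs <;> linarith
  prob_sum x := by cases x <;> simp

end

/-!
The proof rests on a game played on the support of the channel: one player picks an input letter
`x`, the other an output letter `y`, and the payoff is `1` if `W(y|x) > 0` and `0` otherwise. Let
`v > 0` be its value in mixed strategies (Sion's minimax theorem). As `ρ → ∞`, `E₀(ρ)` equals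
`-ρ log₂ v` up to a bounded error, so the sphere-packing exponent is finite exactly for
`R ≥ -log₂ v`, and `R_∞ = -log₂ v` (`DMC.exists_finiteRates_eq_Ici`).

An optimal strategy `s` of the output player is a probability vector on the output alphabet that
gives mass at least `v` to the support of each input letter. Its powers bound list decoding: `M`
messages with lists of length at most `M vⁿ / 2` leave an exponentially large part of the
probability outside the lists (`DMC.card_mul_le_sum_not_mem_list`). With the splitting argument of
Shannon, Gallager and Berlekamp (`DMC.mul_minError_le_minError_add`), in which the first `n₁`
letters of a block only serve to produce a list, this gives a straight-line inequality
`E((1 - l) R₁ + l R₂) ≤ (1 - l) K + l E(R₂)` for `R₁ > R_∞` and `0 < l < 1`, with a constant `K`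
(`DMC.exists_reliability_bounds`). Using it with `l` close to `1`, from `R₀` to a nearby `R` and
from `R` to `R₀`, bounds `E(R)` from above and from below by values near `E(R₀)`
(`DMC.continuousAt_of_straight_line`).
-/

namespace DMC

open Finset Filter Topology

/-! ### The support game -/

section Support

variable {X Y : Type*} [Fintype Y]

/-- The support indicator of the channel: `1` if the letter `y` can be received when `x` is sent,
and `0` otherwise. -/
noncomputable def reach (W : DMC X Y) (x : X) (y : Y) : ℝ := if W.prob x y = 0 then 0 else 1

lemma reach_nonneg (W : DMC X Y) (x : X) (y : Y) : 0 ≤ W.reach x y := by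
  unfold reach; split_ifs <;> norm_num

lemma reach_le_one (W : DMC X Y) (x : X) (y : Y) : W.reach x y ≤ 1 := by
  unfold reach; split_ifs <;> norm_num

lemma exists_prob_ne_zero (W : DMC X Y) (x : X) : ∃ y, W.prob x y ≠ 0 := by
  by_contra! h
  simpa [h] using W.prob_sum x

lemma prob_le_one (W : DMC X Y) (x : X) (y : Y) : W.prob x y ≤ 1 := by
  rw [← W.prob_sum x]
  exact single_le_sum (f := W.prob x) (fun z _ => W.prob_nonneg x z) (mem_univ y)

variable [Fintype X]

lemma exists_pos_le_prob (W : DMC X Y) :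
    ∃ w : ℝ, 0 < w ∧ ∀ x y, W.prob x y ≠ 0 → w ≤ W.prob x y := by
  obtain ⟨w, hw0, hw⟩ := Set.Finite.exists_between' (α := ℝ)
    (s := {0}) (t := (Set.range fun z : X × Y => W.prob z.1 z.2) \ {0})
    (Set.finite_singleton _) ((Set.finite_range _).sdiff) (by
      rintro x rfl y ⟨⟨z, rfl⟩, hz⟩
      exact lt_of_le_of_ne (W.prob_nonneg _ _) (Ne.symm hz))
  exact ⟨w, hw0 0 rfl, fun x y h => (hw _ ⟨⟨(x, y), rfl⟩, h⟩).le⟩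

/-- The zero-sum game on the support of the channel has a value `v`, and both players have an
optimal strategy. -/
lemma exists_support_game_value [Nonempty X] (W : DMC X Y) :
    ∃ v : ℝ, 0 < v ∧ v ≤ 1 ∧ (∃ q ∈ stdSimplex ℝ X, ∀ y, ∑ x, q x * W.reach x y ≤ v) ∧
      ∃ s ∈ stdSimplex ℝ Y, ∀ x, v ≤ ∑ y, s y * W.reach x y := by
  classical
  obtain ⟨x₀⟩ := ‹Nonempty X›
  obtain ⟨y₀, -⟩ := W.exists_prob_ne_zero x₀
  let f : (X → ℝ) →ₗ[ℝ] (Y → ℝ) →ₗ[ℝ] ℝ :=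
    Matrix.toLinearMap₂' ℝ (Matrix.of W.reach)
  have hf1 (q : X → ℝ) (y : Y) : f q (Pi.single y 1) = ∑ x, q x * W.reach x y := by
    simp [f, Matrix.toLinearMap₂'_apply, Pi.single_apply, mul_comm]
  have hf2 (s : Y → ℝ) (x : X) : f (Pi.single x 1) s = ∑ y, s y * W.reach x y := by
    simp [f, Matrix.toLinearMap₂'_apply, Pi.single_apply, mul_comm]
  obtain ⟨q, hq, s, hs, h⟩ := Sion.exists_isSaddlePointOn (X := stdSimplex ℝ X)
    (Y := stdSimplex ℝ Y) (f := fun q s => f q s)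
    ⟨_, single_mem_stdSimplex ℝ x₀⟩ (convex_stdSimplex ℝ X) (isCompact_stdSimplex ℝ X)
    (fun s _ => (LinearMap.continuous_of_finiteDimensional
      (f.flip s)).lowerSemicontinuous.lowerSemicontinuousOn _)
    (fun s _ => ((f.flip s).convexOn (convex_stdSimplex ℝ X)).quasiconvexOn)
    (convex_stdSimplex ℝ Y) ⟨_, single_mem_stdSimplex ℝ y₀⟩ (isCompact_stdSimplex ℝ Y)
    (fun q _ => (LinearMap.continuous_of_finiteDimensional
      (f q)).upperSemicontinuous.upperSemicontinuousOn _)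
    (fun q _ => ((f q).concaveOn (convex_stdSimplex ℝ Y)).quasiconcaveOn)
  have hqv (y : Y) : ∑ x, q x * W.reach x y ≤ f q s := by
    rw [← hf1]; exact h q hq _ (single_mem_stdSimplex ℝ y)
  have hsv (x : X) : f q s ≤ ∑ y, s y * W.reach x y := by
    rw [← hf2]; exact h _ (single_mem_stdSimplex ℝ x) s hs
  refine ⟨f q s, ?_, ?_, ⟨q, hq, hqv⟩, s, hs, hsv⟩
  · obtain ⟨x₁, hx₁⟩ : ∃ x, 0 < q x := by
      by_contra! hle
      have := sum_nonpos fun x (_ : x ∈ univ) => hle x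
      linarith [hq.2]
    obtain ⟨y₁, hy₁⟩ := W.exists_prob_ne_zero x₁
    refine lt_of_lt_of_le hx₁ (le_trans ?_ (hqv y₁))
    calc q x₁ = q x₁ * W.reach x₁ y₁ := by simp [reach, hy₁]
      _ ≤ _ := single_le_sum (f := fun x => q x * W.reach x y₁)
          (fun x _ => mul_nonneg (hq.1 x) (W.reach_nonneg x y₁)) (mem_univ x₁)
  · refine (hsv x₀).trans ?_
    rw [← hs.2]
    exact sum_le_sum fun y _ => mul_le_of_le_one_right (hs.1 y) (W.reach_le_one _ _)

end Support

/-! ### Finiteness of the sphere-packing exponent -/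

section SpherePacking

variable {X Y : Type*} [Fintype X] [Fintype Y]

lemma le_gallager_sum (W : DMC X Y) {w v ρ : ℝ} (hw : 0 < w)
    (hwW : ∀ x y, W.prob x y ≠ 0 → w ≤ W.prob x y) (hv : 0 < v) (hρ : 0 ≤ ρ) {q : X → ℝ}
    (hq : q ∈ stdSimplex ℝ X) {y : Y} (hy : v ≤ ∑ x, q x * W.reach x y) :
    w * v ^ (1 + ρ) ≤ ∑ y, (∑ x, q x * W.prob x y ^ (1 / (1 + ρ))) ^ (1 + ρ) := by
  have hρ' : 0 < 1 + ρ := by linarith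
  have hnn (y : Y) : 0 ≤ ∑ x, q x * W.prob x y ^ (1 / (1 + ρ)) :=
    sum_nonneg fun x _ => mul_nonneg (hq.1 x) (Real.rpow_nonneg (W.prob_nonneg x y) _)
  have h1 : w ^ (1 / (1 + ρ)) * v ≤ ∑ x, q x * W.prob x y ^ (1 / (1 + ρ)) := by
    refine (mul_le_mul_of_nonneg_left hy (Real.rpow_nonneg hw.le _)).trans ?_
    rw [mul_sum]
    refine sum_le_sum fun x _ => ?_
    rw [mul_left_comm]
    refine mul_le_mul_of_nonneg_left ?_ (hq.1 x)
    unfold reach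
    split_ifs with h
    · simpa using Real.rpow_nonneg (W.prob_nonneg x y) _
    · rw [mul_one]
      exact Real.rpow_le_rpow hw.le (hwW x y h) (by positivity)
  calc w * v ^ (1 + ρ) = (w ^ (1 / (1 + ρ)) * v) ^ (1 + ρ) := by
        rw [Real.mul_rpow (Real.rpow_nonneg hw.le _) hv.le, ← Real.rpow_mul hw.le,
          one_div_mul_cancel hρ'.ne', Real.rpow_one]
    _ ≤ (∑ x, q x * W.prob x y ^ (1 / (1 + ρ))) ^ (1 + ρ) :=
        Real.rpow_le_rpow (by positivity) h1 hρ'.le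
    _ ≤ _ := single_le_sum
        (f := fun y => (∑ x, q x * W.prob x y ^ (1 / (1 + ρ))) ^ (1 + ρ))
        (fun y _ => Real.rpow_nonneg (hnn y) _) (mem_univ y)

lemma gallager_sum_le (W : DMC X Y) {v ρ : ℝ} (hρ : 0 ≤ ρ) {q : X → ℝ}
    (hq : q ∈ stdSimplex ℝ X) (hqv : ∀ y, ∑ x, q x * W.reach x y ≤ v) :
    ∑ y, (∑ x, q x * W.prob x y ^ (1 / (1 + ρ))) ^ (1 + ρ) ≤
      Fintype.card Y * v ^ (1 + ρ) := by
  have hρ' : 0 < 1 + ρ := by linarith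
  rw [← nsmul_eq_mul, ← card_univ, ← sum_const]
  refine sum_le_sum fun y _ => Real.rpow_le_rpow
    (sum_nonneg fun x _ => mul_nonneg (hq.1 x) (Real.rpow_nonneg (W.prob_nonneg x y) _))
    (le_trans (sum_le_sum fun x _ => mul_le_mul_of_nonneg_left ?_ (hq.1 x)) (hqv y)) hρ'.le
  unfold reach
  split_ifs with h
  · rw [h, Real.zero_rpow (by positivity)]
  · exact Real.rpow_le_one (W.prob_nonneg x y) (W.prob_le_one x y) (by positivity)

/-- As `ρ → ∞` the function `E₀(ρ)` grows at most like `-ρ log₂ v`. -/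
lemma spherePacking_lt_top (W : DMC X Y) {v R : ℝ} (hv : 0 < v)
    (h : ∀ q ∈ stdSimplex ℝ X, ∃ y, v ≤ ∑ x, q x * W.reach x y) (hR : -Real.logb 2 v ≤ R) :
    W.spherePacking R < ⊤ := by
  obtain ⟨w, hw, hwW⟩ := W.exists_pos_le_prob
  refine lt_of_le_of_lt (iSup₂_le fun ρ hρ => ?_)
    (EReal.coe_lt_top (-Real.logb 2 w - Real.logb 2 v))
  have hρ : 0 ≤ ρ := hρ
  have hG : W.gallagerMax ρ ≤
      ((-Real.logb 2 w - (1 + ρ) * Real.logb 2 v : ℝ) : EReal) := by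
    refine iSup₂_le fun q hq => ?_
    obtain ⟨y, hy⟩ := h q hq
    rw [EReal.coe_le_coe_iff, gallagerFun]
    have := Real.logb_le_logb_of_le (b := 2) one_lt_two (by positivity)
      (W.le_gallager_sum hw hwW hv hρ hq hy)
    rw [Real.logb_mul hw.ne' (by positivity), Real.logb_rpow_eq_mul_logb_of_pos hv] at this
    linarith
  refine (EReal.sub_le_sub hG le_rfl).trans ?_
  rw [← EReal.coe_sub, EReal.coe_le_coe_iff]
  nlinarith

lemma spherePacking_eq_top (W : DMC X Y) {v R : ℝ} (hv : 0 < v) {q : X → ℝ}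
    (hq : q ∈ stdSimplex ℝ X) (hqv : ∀ y, ∑ x, q x * W.reach x y ≤ v)
    (hqy : ∃ y, v ≤ ∑ x, q x * W.reach x y) (hR : R < -Real.logb 2 v) :
    W.spherePacking R = ⊤ := by
  obtain ⟨w, hw, hwW⟩ := W.exists_pos_le_prob
  obtain ⟨y, hy⟩ := hqy
  have : Nonempty Y := ⟨y⟩
  rw [EReal.eq_top_iff_forall_lt]
  intro C
  set c := Real.logb 2 (Fintype.card Y) + Real.logb 2 v with hc
  obtain ⟨N, hN⟩ := exists_nat_gt ((C + c) / (-Real.logb 2 v - R))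
  rw [div_lt_iff₀ (by linarith)] at hN
  have hρ : (0 : ℝ) ≤ N := N.cast_nonneg
  have hG : -Real.logb 2 (Fintype.card Y) - (1 + N) * Real.logb 2 v ≤ W.gallagerFun N q := by
    have hlow := W.le_gallager_sum hw hwW hv hρ hq hy
    have := Real.logb_le_logb_of_le (b := 2) one_lt_two
      (lt_of_lt_of_le (by positivity) hlow) (W.gallager_sum_le hρ hq hqv)
    rw [Real.logb_mul (by positivity) (by positivity),
      Real.logb_rpow_eq_mul_logb_of_pos hv] at this
    unfold gallagerFun
    linarith
  refine lt_of_lt_of_le (b := ((W.gallagerFun N q - N * R : ℝ) : EReal)) ?_ ?_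
  · rw [EReal.coe_lt_coe_iff]
    nlinarith
  · rw [EReal.coe_sub]
    exact (EReal.sub_le_sub (le_iSup₂ (f := fun q (_ : q ∈ stdSimplex ℝ X) =>
      (W.gallagerFun N q : EReal)) q hq) le_rfl).trans
      (le_iSup₂ (f := fun ρ (_ : ρ ∈ Set.Ici (0 : ℝ)) =>
        W.gallagerMax ρ - ((ρ * R : ℝ) : EReal)) (N : ℝ) hρ)

/-- The sphere-packing exponent is finite exactly from the rate `-log₂ v` on, where `v` is the value
of the support game; the strategy `s` certifies that every input letter reaches `s`-mass at least
`v`. -/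
lemma exists_finiteRates_eq_Ici [Nonempty X] (W : DMC X Y) :
    ∃ v : ℝ, 0 < v ∧ W.finiteRates = Set.Ici (-Real.logb 2 v) ∧
      ∃ s ∈ stdSimplex ℝ Y, ∀ x, v ≤ ∑ y, s y * W.reach x y := by
  obtain ⟨v, hv, hv1, ⟨q, hq, hqv⟩, s, hs, hsv⟩ := W.exists_support_game_value
  -- Averaging the guarantee of `s` over `q'` shows that no `q'` does better than `v`.
  have key (q' : X → ℝ) (hq' : q' ∈ stdSimplex ℝ X) :
      ∃ y, v ≤ ∑ x, q' x * W.reach x y := by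
    by_contra! hlt
    obtain ⟨y₀, hy₀⟩ : ∃ y, 0 < s y := by
      by_contra! hle
      have := sum_nonpos fun y (_ : y ∈ univ) => hle y
      linarith [hs.2]
    have h1 : v ≤ ∑ x, q' x * ∑ y, s y * W.reach x y := by
      calc v = ∑ x, q' x * v := by rw [← sum_mul, hq'.2, one_mul]
        _ ≤ _ := sum_le_sum fun x _ => mul_le_mul_of_nonneg_left (hsv x) (hq'.1 x)
    have h2 : ∑ x, q' x * ∑ y, s y * W.reach x y = ∑ y, s y * ∑ x, q' x * W.reach x y := by
      simp only [mul_sum]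
      rw [sum_comm]
      exact sum_congr rfl fun y _ => sum_congr rfl fun x _ => by ring
    have h3 : ∑ y, s y * ∑ x, q' x * W.reach x y < ∑ y, s y * v :=
      sum_lt_sum (fun y _ => mul_le_mul_of_nonneg_left (hlt y).le (hs.1 y))
        ⟨y₀, mem_univ _, mul_lt_mul_of_pos_left (hlt y₀) hy₀⟩
    rw [← sum_mul, hs.2, one_mul] at h3
    linarith
  refine ⟨v, hv, ?_, s, hs, hsv⟩
  ext R
  constructor
  · rintro ⟨-, hR⟩
    by_contra hlt
    exact hR.ne (W.spherePacking_eq_top hv hq hqv (key q hq) (not_le.mp hlt))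
  · intro hR
    have h0 : Real.logb 2 v ≤ 0 := Real.logb_nonpos one_lt_two hv.le hv1
    exact ⟨by linarith [Set.mem_Ici.mp hR], W.spherePacking_lt_top hv key hR⟩

end SpherePacking

/-! ### Lower bounds on the error probability of block codes -/

section Codes

variable {X Y : Type*} [Fintype Y]

lemma wordProb_nonneg (W : DMC X Y) {n : ℕ} (x : Fin n → X) (y : Fin n → Y) :
    0 ≤ W.wordProb x y :=
  prod_nonneg fun _ _ => W.prob_nonneg _ _

lemma sum_wordProb (W : DMC X Y) {n : ℕ} (x : Fin n → X) : ∑ y, W.wordProb x y = 1 := by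
  simp only [wordProb]
  rw [← Fintype.prod_sum (fun i y => W.prob (x i) y)]
  simp [W.prob_sum]

lemma wordProb_append (W : DMC X Y) {n₁ n₂ : ℕ} (x : Fin (n₁ + n₂) → X)
    (y₁ : Fin n₁ → Y) (y₂ : Fin n₂ → Y) :
    W.wordProb x (Fin.append y₁ y₂) =
      W.wordProb (fun i => x (Fin.castAdd n₂ i)) y₁ *
        W.wordProb (fun i => x (Fin.natAdd n₁ i)) y₂ := by
  simp [wordProb, Fin.prod_univ_add]

/-- The sphere-packing argument at the level of supports, for list decoding: if the lists `A y` are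
shorter than half of `|ι| vⁿ`, the pairs (message, output word) that are possible but not listed
carry an exponentially large part of the probability. Here `s` reaches the support of each input
letter with mass at least `v`, and `w` bounds the positive transition probabilities from below. -/
lemma card_mul_le_sum_not_mem_list (W : DMC X Y) {w v : ℝ} (hw : 0 ≤ w)
    (hwW : ∀ x y, W.prob x y ≠ 0 → w ≤ W.prob x y) (hv : 0 ≤ v) {s : Y → ℝ}
    (hs : s ∈ stdSimplex ℝ Y) (hsv : ∀ x, v ≤ ∑ y, s y * W.reach x y)
    {ι : Type*} [Fintype ι] [DecidableEq ι] {n : ℕ} (f : ι → Fin n → X) (A : (Fin n → Y) → Finset ι) {L : ℝ}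
    (hA : ∀ y, ((A y).card : ℝ) ≤ L) (hL : 2 * L ≤ Fintype.card ι * v ^ n) :
    Fintype.card ι * ((w * v) ^ n / 2) ≤
      ∑ m, ∑ y, if m ∈ A y then 0 else W.wordProb (f m) y := by
  have hs1 (y : Y) : s y ≤ 1 := by
    rw [← hs.2]; exact single_le_sum (f := s) (fun z _ => hs.1 z) (mem_univ y)
  have hS (y : Fin n → Y) : 0 ≤ ∏ i, s (y i) := prod_nonneg fun _ _ => hs.1 _
  have hterm (m : ι) (y : Fin n → Y) :
      w ^ n * ∏ i, (s (y i) * W.reach (f m i) (y i)) -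
          w ^ n * (if m ∈ A y then ∏ i, s (y i) else 0) ≤
        if m ∈ A y then 0 else W.wordProb (f m) y := by
    split_ifs
    · rw [prod_mul_distrib, sub_nonpos]
      exact mul_le_mul_of_nonneg_left (mul_le_of_le_one_right (hS y)
        (prod_le_one (fun i _ => W.reach_nonneg _ _) fun i _ => W.reach_le_one _ _))
        (pow_nonneg hw n)
    · rw [mul_zero, sub_zero]
      calc w ^ n * ∏ i, (s (y i) * W.reach (f m i) (y i))
          = ∏ i, (w * (s (y i) * W.reach (f m i) (y i))) := by
            rw [prod_mul_distrib (f := fun _ => w)]; simp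
        _ ≤ W.wordProb (f m) y := by
            refine prod_le_prod (fun i _ => mul_nonneg hw
              (mul_nonneg (hs.1 _) (W.reach_nonneg _ _))) fun i _ => ?_
            unfold reach
            split_ifs with h
            · simp [h]
            · rw [mul_one]
              exact (mul_le_of_le_one_right hw (hs1 _)).trans (hwW _ _ h)
  have hmass (m : ι) : v ^ n ≤ ∑ y : Fin n → Y, ∏ i, (s (y i) * W.reach (f m i) (y i)) := by
    rw [← Fintype.prod_sum (fun i y => s y * W.reach (f m i) y)]
    calc v ^ n = ∏ _i : Fin n, v := by simp
      _ ≤ _ := prod_le_prod (fun _ _ => hv) fun i _ => hsv _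
  have hsum : ∑ y : Fin n → Y, ∏ i, s (y i) = 1 := by
    rw [← Fintype.prod_sum (fun _ y => s y)]
    simp [hs.2]
  have hlist : ∑ m, ∑ y, (if m ∈ A y then ∏ i, s (y i) else 0) ≤ L := by
    rw [sum_comm]
    calc ∑ y, ∑ m, (if m ∈ A y then ∏ i, s (y i) else 0)
        = ∑ y, ((A y).card : ℝ) * ∏ i, s (y i) := by simp
      _ ≤ ∑ y : Fin n → Y, L * ∏ i, s (y i) :=
          sum_le_sum fun y _ => mul_le_mul_of_nonneg_right (hA y) (hS y)
      _ = L := by rw [← mul_sum, hsum, mul_one]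
  have hall : Fintype.card ι * v ^ n ≤
      ∑ m, ∑ y : Fin n → Y, ∏ i, (s (y i) * W.reach (f m i) (y i)) := by
    rw [← nsmul_eq_mul, ← card_univ, ← sum_const]
    exact sum_le_sum fun m _ => hmass m
  have hwn := pow_nonneg hw n
  calc Fintype.card ι * ((w * v) ^ n / 2)
      = w ^ n * (Fintype.card ι * v ^ n - Fintype.card ι * v ^ n / 2) := by
        rw [mul_pow]; ring
    _ ≤ w ^ n * (∑ m, ∑ y : Fin n → Y, ∏ i, (s (y i) * W.reach (f m i) (y i)) -
          ∑ m, ∑ y, (if m ∈ A y then ∏ i, s (y i) else 0)) :=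
        mul_le_mul_of_nonneg_left (by linarith) hwn
    _ = ∑ m, ∑ y, (w ^ n * ∏ i, (s (y i) * W.reach (f m i) (y i)) -
          w ^ n * (if m ∈ A y then ∏ i, s (y i) else 0)) := by
        simp only [sum_sub_distrib, mul_sub, mul_sum]
    _ ≤ _ := sum_le_sum fun m _ => sum_le_sum fun y _ => hterm m y

lemma le_minError [Nonempty X] (W : DMC X Y) {n M : ℕ} (hM : M ≠ 0) {t : ℝ}
    (h : ∀ (f : Fin M → Fin n → X) (g : (Fin n → Y) → Fin M), t ≤ W.avgError f g) :
    t ≤ W.minError n M := by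
  have : NeZero M := ⟨hM⟩
  exact le_ciInf fun c => h c.1 c.2

lemma minError_nonneg [Nonempty X] (W : DMC X Y) {n M : ℕ} (hM : M ≠ 0) :
    0 ≤ W.minError n M := by
  refine W.le_minError hM fun f g => div_nonneg (sum_nonneg fun m _ => sum_nonneg fun y _ => ?_)
    M.cast_nonneg
  split_ifs
  exacts [le_rfl, W.wordProb_nonneg _ _]

lemma pow_div_two_le_minError [Nonempty X] (W : DMC X Y) {w v : ℝ} (hw : 0 ≤ w)
    (hwW : ∀ x y, W.prob x y ≠ 0 → w ≤ W.prob x y) (hv : 0 ≤ v) {s : Y → ℝ}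
    (hs : s ∈ stdSimplex ℝ Y) (hsv : ∀ x, v ≤ ∑ y, s y * W.reach x y) {n M : ℕ} (hM : M ≠ 0)
    (hM2 : 2 ≤ M * v ^ n) : (w * v) ^ n / 2 ≤ W.minError n M := by
  classical
  refine W.le_minError hM fun f g => ?_
  rw [avgError, le_div_iff₀ (by positivity), mul_comm]
  simpa [eq_comm] using W.card_mul_le_sum_not_mem_list hw hwW hv hs hsv f (fun y => {g y})
    (L := 1) (by simp) (by simpa using hM2)

variable [Fintype X]

lemma minError_le_avgError (W : DMC X Y) {n M : ℕ} (f : Fin M → Fin n → X)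
    (g : (Fin n → Y) → Fin M) : W.minError n M ≤ W.avgError f g :=
  ciInf_le (f := fun c : (Fin M → Fin n → X) × ((Fin n → Y) → Fin M) => W.avgError c.1 c.2)
    (Set.finite_range _).bddBelow (f, g)

lemma minError_le_one [Nonempty X] (W : DMC X Y) {n M : ℕ} (hM : M ≠ 0) :
    W.minError n M ≤ 1 := by
  have : NeZero M := ⟨hM⟩
  obtain ⟨f⟩ : Nonempty (Fin M → Fin n → X) := inferInstance
  refine (W.minError_le_avgError f fun _ => 0).trans (div_le_one_of_le₀ ?_ M.cast_nonneg)
  calc _ ≤ ∑ m : Fin M, ∑ y, W.wordProb (f m) y := by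
        refine sum_le_sum fun m _ => sum_le_sum fun y _ => ?_
        split_ifs
        exacts [W.wordProb_nonneg _ _, le_rfl]
    _ = M := by simp [sum_wordProb]

open Classical in
/-- In any code at most `L` messages have error probability below the optimum for `L + 1` messages:
otherwise the subcode of `L + 1` such messages would beat that optimum. -/
lemma card_lt_minError_le (W : DMC X Y) {n M : ℕ} (f : Fin M → Fin n → X)
    (g : (Fin n → Y) → Fin M) (L : ℕ) :
    (univ.filter fun m => (∑ y, if g y = m then 0 else W.wordProb (f m) y) <
      W.minError n (L + 1)).card ≤ L := by
  by_contra! hlt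
  obtain ⟨t, ht, htL⟩ := exists_subset_card_eq (Nat.succ_le_of_lt hlt)
  let e : t ≃ Fin (L + 1) := t.equivFinOfCardEq htL
  let f' : Fin (L + 1) → Fin n → X := fun k => f (e.symm k)
  let g' : (Fin n → Y) → Fin (L + 1) := fun y => if h : g y ∈ t then e ⟨g y, h⟩ else 0
  have hg (k : Fin (L + 1)) (y : Fin n → Y) (h : g y = e.symm k) : g' y = k := by
    have hmem : g y ∈ t := h ▸ (e.symm k).2
    have : (⟨g y, hmem⟩ : t) = e.symm k := Subtype.ext h
    simp only [g', dif_pos hmem, this, Equiv.apply_symm_apply]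
  have hk (k : Fin (L + 1)) : (∑ y, if g' y = k then 0 else W.wordProb (f' k) y) <
      W.minError n (L + 1) := by
    refine lt_of_le_of_lt (sum_le_sum fun y _ => ?_) (mem_filter.mp (ht (e.symm k).2)).2
    by_cases h : g y = e.symm k
    · rw [if_pos h, if_pos (hg k y h)]
    · rw [if_neg h]
      split_ifs
      exacts [W.wordProb_nonneg _ _, le_rfl]
  have hlt' : W.avgError f' g' < W.minError n (L + 1) := by
    rw [avgError, div_lt_iff₀ (by positivity)]
    calc _ < ∑ _k : Fin (L + 1), W.minError n (L + 1) :=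
          sum_lt_sum_of_nonempty univ_nonempty fun k _ => hk k
      _ = _ := by simp [mul_comm]
  exact absurd (W.minError_le_avgError f' g') (not_le.mpr hlt')

/-- Splitting a block into a prefix and a suffix: a decoder that sees only the prefix may be
regarded as producing the list of the at most `L` messages that the suffix still resolves well; any
other message is decoded wrongly with at least the optimal probability for `L + 1` messages. -/
lemma mul_minError_le_minError_add [Nonempty X] (W : DMC X Y) {w v : ℝ} (hw : 0 ≤ w)
    (hwW : ∀ x y, W.prob x y ≠ 0 → w ≤ W.prob x y) (hv : 0 ≤ v) {s : Y → ℝ}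
    (hs : s ∈ stdSimplex ℝ Y) (hsv : ∀ x, v ≤ ∑ y, s y * W.reach x y) {n₁ n₂ M L : ℕ}
    (hM : M ≠ 0) (hL : 2 * (L : ℝ) ≤ M * v ^ n₁) :
    (w * v) ^ n₁ / 2 * W.minError n₂ (L + 1) ≤ W.minError (n₁ + n₂) M := by
  classical
  refine W.le_minError hM fun f g => ?_
  let a : Fin M → Fin n₁ → X := fun m i => f m (Fin.castAdd n₂ i)
  let b : Fin M → Fin n₂ → X := fun m i => f m (Fin.natAdd n₁ i)
  let e : (Fin n₁ → Y) → Fin M → ℝ := fun y₁ m =>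
    ∑ y₂, if g (Fin.append y₁ y₂) = m then 0 else W.wordProb (b m) y₂
  let P := W.minError n₂ (L + 1)
  have hP : 0 ≤ P := W.minError_nonneg L.succ_ne_zero
  let A : (Fin n₁ → Y) → Finset (Fin M) := fun y₁ => univ.filter fun m => e y₁ m < P
  have hA (y₁ : Fin n₁ → Y) : ((A y₁).card : ℝ) ≤ L :=
    Nat.cast_le.mpr (W.card_lt_minError_le b (fun y₂ => g (Fin.append y₁ y₂)) L)
  have hsplit (m : Fin M) : (∑ y, if g y = m then 0 else W.wordProb (f m) y) =
      ∑ y₁, W.wordProb (a m) y₁ * e y₁ m := by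
    rw [← (Fin.appendEquiv n₁ n₂).sum_comp, Fintype.sum_prod_type]
    refine sum_congr rfl fun y₁ _ => ?_
    rw [mul_sum]
    refine sum_congr rfl fun y₂ _ => ?_
    simp only [Fin.appendEquiv, Equiv.coe_fn_mk, wordProb_append, mul_ite, mul_zero, a, b]
  rw [avgError, le_div_iff₀ (by positivity)]
  calc (w * v) ^ n₁ / 2 * P * M
      = (Fintype.card (Fin M) * ((w * v) ^ n₁ / 2)) * P := by rw [Fintype.card_fin]; ring
    _ ≤ (∑ m, ∑ y₁, if m ∈ A y₁ then 0 else W.wordProb (a m) y₁) * P :=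
        mul_le_mul_of_nonneg_right (W.card_mul_le_sum_not_mem_list hw hwW hv hs hsv a A hA
          (by simpa using hL)) hP
    _ ≤ ∑ m, ∑ y₁, W.wordProb (a m) y₁ * e y₁ m := by
        simp only [sum_mul]
        refine sum_le_sum fun m _ => sum_le_sum fun y₁ _ => ?_
        have he : 0 ≤ e y₁ m := sum_nonneg fun y₂ _ => by
          split_ifs
          exacts [le_rfl, W.wordProb_nonneg _ _]
        split_ifs with h
        · rw [zero_mul]
          exact mul_nonneg (W.wordProb_nonneg _ _) he
        · refine mul_le_mul_of_nonneg_left ?_ (W.wordProb_nonneg _ _)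
          simpa [A] using h
    _ = _ := sum_congr rfl fun m _ => by rw [← hsplit]

end Codes

/-! ### Exponents -/

section Rates

variable {X Y : Type*} [Fintype Y]

lemma negLogTwo_div_le_iff {t a : ℝ} {n : ℕ} (hn : n ≠ 0) :
    negLogTwo t / (n : EReal) ≤ (a : EReal) ↔ (2 : ℝ) ^ (-(n * a)) ≤ t := by
  have hn' : (n : EReal) = ((n : ℝ) : EReal) := rfl
  rw [EReal.div_le_iff_le_mul (by rw [hn']; exact_mod_cast Nat.pos_of_ne_zero hn)
    (by rw [hn']; exact EReal.coe_ne_top _), hn', ← EReal.coe_mul, negLogTwo]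
  split_ifs with h
  · simp only [top_le_iff, EReal.coe_ne_top, false_iff, not_le]
    exact lt_of_le_of_lt h (by positivity)
  · rw [EReal.coe_le_coe_iff, neg_le, Real.le_logb_iff_rpow_le one_lt_two (not_le.mp h)]

lemma eventually_le_minError_of_reliability_lt (W : DMC X Y) {R a : ℝ}
    (h : W.reliability R < (a : EReal)) :
    ∀ᶠ n : ℕ in atTop, (2 : ℝ) ^ (-(n * a)) ≤ W.minError n ⌈(2 : ℝ) ^ ((n : ℝ) * R)⌉₊ := by
  filter_upwards [eventually_lt_of_limsup_lt h, eventually_ne_atTop 0] with n hn hn0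
  exact (negLogTwo_div_le_iff hn0).mp hn.le

lemma reliability_le_of_eventually_le_minError (W : DMC X Y) {R a : ℝ}
    (h : ∀ᶠ n : ℕ in atTop,
      (2 : ℝ) ^ (-(n * a)) ≤ W.minError n ⌈(2 : ℝ) ^ ((n : ℝ) * R)⌉₊) :
    W.reliability R ≤ (a : EReal) := by
  refine limsup_le_of_le (by isBoundedDefault) ?_
  filter_upwards [h, eventually_ne_atTop 0] with n hn hn0
  exact (negLogTwo_div_le_iff hn0).mpr hn

lemma ceil_two_rpow_ne_zero (x : ℝ) : ⌈(2 : ℝ) ^ x⌉₊ ≠ 0 :=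
  (Nat.ceil_pos.mpr (by positivity)).ne'

lemma two_rpow_mul_logb {v : ℝ} (hv : 0 < v) (n : ℕ) :
    (2 : ℝ) ^ (n * Real.logb 2 v) = v ^ n := by
  rw [mul_comm, Real.rpow_mul zero_le_two, Real.rpow_logb two_pos (by norm_num) hv,
    Real.rpow_natCast]

/-- The fractional error made in rounding `(1 - l) n` down to an integer is absorbed by a strict
inequality between the limits. -/
lemma eventually_one_add_floor_mul_add_le {l x y c : ℝ} (hl1 : l ≤ 1)
    (h : (1 - l) * x + l * y < c) :
    ∀ᶠ n : ℕ in atTop,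
      1 + (⌊(1 - l) * n⌋₊ : ℝ) * x + (n - ⌊(1 - l) * n⌋₊ : ℝ) * y ≤ n * c := by
  have hlim : Tendsto (fun n : ℕ => (n : ℝ) * (c - ((1 - l) * x + l * y))) atTop atTop :=
    tendsto_natCast_atTop_atTop.atTop_mul_const (by linarith)
  filter_upwards [hlim.eventually_ge_atTop (1 + |y - x|)] with n hn
  have h0 : 0 ≤ (1 - l) * n := mul_nonneg (by linarith) n.cast_nonneg
  have h1 := Nat.floor_le h0
  have h2 := Nat.lt_floor_add_one ((1 - l) * n)
  have h3 : ((1 - l) * n - ⌊(1 - l) * n⌋₊) * (y - x) ≤ |y - x| :=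
    calc _ ≤ ((1 - l) * n - ⌊(1 - l) * n⌋₊) * |y - x| :=
          mul_le_mul_of_nonneg_left (le_abs_self _) (by linarith)
      _ ≤ 1 * |y - x| := mul_le_mul_of_nonneg_right (by linarith) (abs_nonneg _)
      _ = _ := one_mul _
  nlinarith

variable [Fintype X]

lemma reliability_nonneg [Nonempty X] (W : DMC X Y) (R : ℝ) : 0 ≤ W.reliability R := by
  refine le_limsup_of_frequently_le (Eventually.frequently ?_) (by isBoundedDefault)
  refine Eventually.of_forall fun n => EReal.div_nonneg ?_ (by positivity)
  rw [negLogTwo]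
  split_ifs with h
  · exact le_top
  · rw [EReal.coe_nonneg, neg_nonneg]
    exact Real.logb_nonpos one_lt_two (not_le.mp h).le
      (W.minError_le_one (ceil_two_rpow_ne_zero _))

/-- The straight-line inequality. Its end point at rate `-log₂ v` is a crude finite exponent `K`
rather than the sphere-packing exponent, which is enough for continuity. -/
lemma exists_reliability_bounds [Nonempty X] (W : DMC X Y) {v : ℝ} (hv : 0 < v) {s : Y → ℝ}
    (hs : s ∈ stdSimplex ℝ Y) (hsv : ∀ x, v ≤ ∑ y, s y * W.reach x y) :
    ∃ K : ℝ, (∀ R, -Real.logb 2 v < R → W.reliability R < ⊤) ∧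
      ∀ l R R' a b : ℝ, 0 < l → l < 1 → W.reliability R' < (a : EReal) →
        (1 - l) * (-Real.logb 2 v) + l * R' < R → (1 - l) * K + l * a < b →
        W.reliability R ≤ (b : EReal) := by
  obtain ⟨w, hw, hwW⟩ := W.exists_pos_le_prob
  have hwv : 0 < w * v := mul_pos hw hv
  refine ⟨-Real.logb 2 (w * v), fun R hR => ?_, fun l R R' a b hl0 hl1 ha hR hb => ?_⟩
  · refine lt_of_le_of_lt (W.reliability_le_of_eventually_le_minError
      (a := -Real.logb 2 (w * v) + 1) ?_) (EReal.coe_lt_top _)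
    have hlim : Tendsto (fun n : ℕ => (n : ℝ) * (R + Real.logb 2 v)) atTop atTop :=
      tendsto_natCast_atTop_atTop.atTop_mul_const (by linarith)
    filter_upwards [hlim.eventually_ge_atTop 1, eventually_ge_atTop 1] with n hn hn1
    refine le_trans ?_ (W.pow_div_two_le_minError hw.le hwW hv.le hs hsv
      (ceil_two_rpow_ne_zero _) ?_)
    · have hn1' : (1 : ℝ) ≤ n := by exact_mod_cast hn1
      rw [← two_rpow_mul_logb hwv, ← Real.rpow_sub_one two_ne_zero]
      exact Real.rpow_le_rpow_of_exponent_le one_le_two (by linarith)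
    · calc (2 : ℝ) = 2 ^ (1 : ℝ) := (Real.rpow_one 2).symm
        _ ≤ 2 ^ (n * R + n * Real.logb 2 v) :=
            Real.rpow_le_rpow_of_exponent_le one_le_two (by linarith)
        _ = 2 ^ (n * R) * v ^ n := by rw [Real.rpow_add two_pos, two_rpow_mul_logb hv]
        _ ≤ _ := mul_le_mul_of_nonneg_right (Nat.le_ceil _) (by positivity)
  · refine W.reliability_le_of_eventually_le_minError ?_
    have hfl (n : ℕ) : ⌊(1 - l) * n⌋₊ ≤ n := by
      refine Nat.floor_le_of_le ?_
      exact mul_le_of_le_one_left n.cast_nonneg (by linarith)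
    have hlim : Tendsto (fun n : ℕ => n - ⌊(1 - l) * n⌋₊) atTop atTop := by
      rw [← tendsto_natCast_atTop_iff (R := ℝ)]
      refine tendsto_atTop_mono (fun n => ?_)
        (tendsto_natCast_atTop_atTop.const_mul_atTop hl0 : Tendsto (fun n : ℕ => l * (n : ℝ)) _ _)
      rw [Nat.cast_sub (hfl n)]
      linarith [Nat.floor_le (mul_nonneg (by linarith : 0 ≤ 1 - l) (n.cast_nonneg (α := ℝ)))]
    filter_upwards [hlim.eventually (W.eventually_le_minError_of_reliability_lt ha),
      eventually_one_add_floor_mul_add_le hl1.le hR,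
      eventually_one_add_floor_mul_add_le hl1.le hb] with n hn hnR hnb
    rw [← Nat.cast_sub (hfl n)] at hnR hnb
    obtain ⟨n₁, hn₁⟩ : ∃ k, k = ⌊(1 - l) * n⌋₊ := ⟨_, rfl⟩
    obtain ⟨n₂, hn₂⟩ : ∃ k, k = n - n₁ := ⟨_, rfl⟩
    have hadd : n = n₁ + n₂ := by have := hfl n; omega
    rw [← hn₁, ← hn₂] at hn hnR hnb
    obtain ⟨L, hL⟩ := Nat.exists_eq_succ_of_ne_zero (ceil_two_rpow_ne_zero (n₂ * R'))
    have hLle : (L : ℝ) ≤ 2 ^ (n₂ * R') := by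
      have := Nat.ceil_lt_add_one (Real.rpow_nonneg zero_le_two (n₂ * R'))
      rw [hL] at this
      push_cast at this
      linarith
    rw [hL] at hn
    have hM : 2 * (L : ℝ) ≤ ⌈(2 : ℝ) ^ ((n : ℝ) * R)⌉₊ * v ^ n₁ :=
      calc 2 * (L : ℝ) ≤ 2 ^ (1 : ℝ) * 2 ^ (n₂ * R') := by rw [Real.rpow_one]; linarith
        _ = 2 ^ (1 + n₂ * R') := (Real.rpow_add two_pos _ _).symm
        _ ≤ 2 ^ (n * R + n₁ * Real.logb 2 v) :=
            Real.rpow_le_rpow_of_exponent_le one_le_two (by linarith)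
        _ = 2 ^ (n * R) * v ^ n₁ := by rw [Real.rpow_add two_pos, two_rpow_mul_logb hv]
        _ ≤ _ := mul_le_mul_of_nonneg_right (Nat.le_ceil _) (by positivity)
    have hmain := W.mul_minError_le_minError_add hw.le hwW hv.le hs hsv (n₂ := n₂)
      (ceil_two_rpow_ne_zero _) hM
    rw [← hadd] at hmain
    refine le_trans ?_ hmain
    calc (2 : ℝ) ^ (-(n * b)) ≤ 2 ^ ((n₁ * Real.logb 2 (w * v) - 1) + -(n₂ * a)) :=
          Real.rpow_le_rpow_of_exponent_le one_le_two (by linarith)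
      _ = (w * v) ^ n₁ / 2 * 2 ^ (-(n₂ * a)) := by
          rw [Real.rpow_add two_pos, Real.rpow_sub_one two_ne_zero, two_rpow_mul_logb hwv]
      _ ≤ _ := mul_le_mul_of_nonneg_left hn (by positivity)

end Rates

/-! ### Continuity -/

/-- An extended-real function satisfying the straight-line inequality towards an end point `r` is
continuous at every point to the right of `r` where it is finite. Both bounds apply the inequality
with weight `l` close to `1`, the point of evaluation being in turn the left-hand side and the
right-hand side. -/
lemma continuousAt_of_straight_line {E : ℝ → EReal} {r K R₀ e : ℝ} (hr : r < R₀)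
    (he : E R₀ = (e : EReal))
    (h : ∀ l R R' a b : ℝ, 0 < l → l < 1 → E R' < (a : EReal) →
        (1 - l) * r + l * R' < R → (1 - l) * K + l * a < b → E R ≤ (b : EReal)) :
    ContinuousAt E R₀ := by
  have weight (a b : ℝ) (hab : a < b) : ∃ l : ℝ, 0 < l ∧ l < 1 ∧ (1 - l) * K + l * a < b := by
    have hc : Tendsto (fun l : ℝ => (1 - l) * K + l * a) (𝓝[<] 1) (𝓝 a) := by
      have : Continuous fun l : ℝ => (1 - l) * K + l * a := by fun_prop
      simpa using (this.tendsto 1).mono_left nhdsWithin_le_nhds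
    obtain ⟨l, hl, hl01⟩ := ((hc.eventually_lt_const hab).and
      (Ioo_mem_nhdsLT (zero_lt_one (α := ℝ)))).exists
    exact ⟨l, hl01.1, hl01.2, hl⟩
  rw [ContinuousAt, he, tendsto_order]
  constructor
  · intro x hx
    obtain ⟨a, hxa, hae⟩ := EReal.exists_between_coe_real hx
    rw [EReal.coe_lt_coe_iff] at hae
    obtain ⟨a', haa', ha'e⟩ := exists_between hae
    obtain ⟨b, ha'b, hbe⟩ := exists_between ha'e
    obtain ⟨l, hl0, hl1, hl⟩ := weight a' b ha'b
    have hc : Tendsto (fun R : ℝ => (1 - l) * r + l * R) (𝓝 R₀) (𝓝 ((1 - l) * r + l * R₀)) :=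
      (by fun_prop : Continuous fun R : ℝ => (1 - l) * r + l * R).tendsto R₀
    filter_upwards [hc.eventually_lt_const (u := R₀) (by nlinarith)] with R hR
    by_contra hle
    have hRa : E R < (a' : EReal) :=
      (not_lt.mp hle).trans_lt (hxa.trans (EReal.coe_lt_coe_iff.mpr haa'))
    have := h l R₀ R a' b hl0 hl1 hRa hR hl
    rw [he, EReal.coe_le_coe_iff] at this
    linarith
  · intro x hx
    obtain ⟨b, heb, hbx⟩ := EReal.exists_between_coe_real hx
    rw [EReal.coe_lt_coe_iff] at heb
    obtain ⟨a, hea, hab⟩ := exists_between heb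
    obtain ⟨l, hl0, hl1, hl⟩ := weight a b hab
    filter_upwards [lt_mem_nhds (show (1 - l) * r + l * R₀ < R₀ by nlinarith)] with R hR
    exact (h l R R₀ a b hl0 hl1 (he ▸ EReal.coe_lt_coe_iff.mpr hea) hR hl).trans_lt hbx

theorem isLeast_rInfty_and_continuousAt_reliability {X Y : Type*} [Fintype X] [Fintype Y]
    [Nonempty X] (W : DMC X Y) :
    IsLeast W.finiteRates W.rInfty ∧
      ∀ R : ℝ, W.rInfty < R →
        W.reliability R ≠ ⊤ ∧ W.reliability R ≠ ⊥ ∧ ContinuousAt W.reliability R := by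
  obtain ⟨v, hv, hrates, s, hs, hsv⟩ := W.exists_finiteRates_eq_Ici
  obtain ⟨K, hfin, hline⟩ := W.exists_reliability_bounds hv hs hsv
  have hr : W.rInfty = -Real.logb 2 v := by rw [rInfty, hrates, csInf_Ici]
  rw [hr, hrates]
  refine ⟨isLeast_Ici, fun R hR => ?_⟩
  have htop : W.reliability R ≠ ⊤ := (hfin R hR).ne
  have hbot : W.reliability R ≠ ⊥ := (EReal.bot_lt_zero.trans_le (W.reliability_nonneg R)).ne'
  exact ⟨htop, hbot, continuousAt_of_straight_line hR (EReal.coe_toReal htop hbot).symm hline⟩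

/-- All transition probabilities of the binary symmetric channel are positive, so its support game
has value `1`. -/
lemma rInfty_bsc_nonpos {p : ℝ} (h0 : 0 < p) (h1 : p < 1) : (bsc p h0.le h1.le).rInfty ≤ 0 := by
  refine csInf_le ⟨0, fun R hR => hR.1⟩ ⟨le_rfl, spherePacking_lt_top _ one_pos ?_ (by simp)⟩
  intro q hq
  have hreach (x y : Bool) : (bsc p h0.le h1.le).reach x y = 1 := by
    have : (bsc p h0.le h1.le).prob x y ≠ 0 := by
      simp only [bsc]
      split_ifs <;> linarith
    simp [reach, this]
  exact ⟨true, by simp only [hreach, mul_one]; exact hq.2.ge⟩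

end DMC

theorem mainTheorem4 :
    (∀ {X Y : Type*} [Fintype X] [Fintype Y] [Nonempty X] (W : DMC X Y),
      IsLeast W.finiteRates W.rInfty ∧
      ∀ R : ℝ, W.rInfty < R →
        W.reliability R ≠ ⊤ ∧ W.reliability R ≠ ⊥ ∧ ContinuousAt W.reliability R) ∧
    (∀ (p : ℝ) (h0 : 0 < p) (h1 : p < 1 / 2) (R : ℝ), 0 < R →
      (bsc p h0.le (by linarith)).reliability R ≠ ⊤ ∧
      (bsc p h0.le (by linarith)).reliability R ≠ ⊥ ∧
      ContinuousAt (bsc p h0.le (by linarith)).reliability R) := by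
  refine ⟨fun W => W.isLeast_rInfty_and_continuousAt_reliability, fun p h0 h1 R hR => ?_⟩
  exact (bsc p h0.le (by linarith)).isLeast_rInfty_and_continuousAt_reliability.2 R
    ((DMC.rInfty_bsc_nonpos h0 (by linarith)).trans_lt hR)
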